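/- Let $p$ be a prime, $K\ge 1$, and $d,m,m'\ge 0$ integers. An instance of the symmetric linear computation broadcast problem (LCBC) over $\mathbb F_q$, $q=p^n$, consists of matrices ${\bf v}_k\in\mathbb F_q^{d\times m}$ and ${\bf v}_k'\in\mathbb F_q^{d\times m'}$, $k=1,\dots,K$. An achievable scheme consists of a batch size $L\ge 1$, a finite alphabet $\mathcal S$, an encoder $\Phi$ mapping the data ${\bf x}\in\mathbb F_q^{d\times L}$ to $\mathcal S$, and decoders $\Psi_k:\mathcal S\times\mathbb F_q^{L\times m'}\to\mathbb F_q^{L\times m}$ (all arbitrary functions) with $\Psi_k(\Phi({\bf x}),{\bf x}^T{\bf v}_k')={\bf x}^T{\bf v}_k$ for all ${\bf x}$ and all $k$; its cost is $\log_q|\mathcal S|/L$. The optimal cost $\Delta^*$ of an instance is the infimum of the costs of its achievable schemes. Let $\Lambda_n$ be a uniformly random instance over $\mathbb F_{p^n}$ (with $p,K,d,m,m'$ fixed). The generic cost $\Delta_g$, if it exists, is the number to which $\Delta^*(\Lambda_n)$ converges in probability as $n\to\infty$, and the generic capacity is $C_g=1/\Delta_g$ (with $1/0=\infty$). Then: 1.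 If $d\le m'$, then $\Delta_g$ exists and $\Delta_g=0$. 2. If $m'\le d\le m+m'$, then $\Delta_g$ exists and $\Delta_g=d-m'$. 3. If $d\ge K(m+m')$, then $\Delta_g$ exists and $\Delta_g=Km$. 4. Suppose $m+m'>0$ and $1<\frac{d}{m+m'}\le K$. (a) If $\Delta_g$ exists, then $$\max\left\{d-m'\left\lceil\frac{d}{m+m'}\right\rceil,\ m\left\lfloor\frac{d}{m+m'}\right\rfloor\right\}\le\Delta_g\le\frac{md}{m+m'}.$$ (b) If $m+m'$ divides $d$, then $\Delta_g$ exists and $\Delta_g=\frac{md}{m+m'}$. (c) One has $\frac{d/(m+m')}{\lfloor d/(m+m')\rfloor}\le 2$, and for $m>0$ this quotient equals $\frac{md/(m+m')}{m\lfloor d/(m+m')\rfloor}$. Consequently, if the generic capacity exists, it is determined within a factor of $2$: $\ \frac{1}{md/(m+m')}\le C_g\le \frac{2}{md/(m+m')}$ (with $1/0=2/0=\infty$). -/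

import Mathlib

open Filter Topology

noncomputable section

namespace LCBC

/-- An instance of the linear computation broadcast problem over `F` with `K` users, data dimension
`d`, demand dimensions `m k` and side-information dimensions `m' k`: the coefficient matrices. -/
structure Instance (F : Type) (K d : ℕ) (m m' : Fin K → ℕ) where
  /-- Coefficients `v_k` of the desired computation of user `k`. -/
  demand : ∀ k, Matrix (Fin d) (Fin (m k)) F
  /-- Coefficients `v'_k` of the side information of user `k`. -/
  side : ∀ k, Matrix (Fin d) (Fin (m' k)) F

instance instFinite (F : Type) [Finite F] (K d : ℕ) (m m' : Fin K → ℕ) :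
    Finite (Instance F K d m m') :=
  Finite.of_injective
    (fun Λ => ((Λ.demand, Λ.side) :
      (∀ k, Matrix (Fin d) (Fin (m k)) F) × (∀ k, Matrix (Fin d) (Fin (m' k)) F)))
    (by rintro ⟨a, b⟩ ⟨a', b'⟩ h; simpa using h)

variable {F : Type} [Field F] {K d : ℕ} {m m' : Fin K → ℕ}

/-- An achievable coding scheme: batch size `L ≥ 1`, a finite alphabet, an (arbitrary) encoder and
(arbitrary) decoders such that every user recovers its demand for every data realization. The
columns of `x` are the `L` data vectors. -/
structure AchievableScheme (Λ : Instance F K d m m') where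
  L : ℕ
  L_pos : 0 < L
  Alphabet : Type
  [fintypeAlphabet : Fintype Alphabet]
  encode : Matrix (Fin d) (Fin L) F → Alphabet
  decode : ∀ k, Alphabet → Matrix (Fin L) (Fin (m' k)) F → Matrix (Fin L) (Fin (m k)) F
  correct : ∀ (x : Matrix (Fin d) (Fin L) F) (k : Fin K),
    decode k (encode x) (x.transpose * Λ.side k) = x.transpose * Λ.demand k

attribute [instance] AchievableScheme.fintypeAlphabet

/-- The normalized broadcast cost `log_q |S| / L`, where `q = |F|`. -/
def AchievableScheme.cost {Λ : Instance F K d m m'} (σ : AchievableScheme Λ) : ℝ :=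
  Real.logb (Nat.card F) (Fintype.card σ.Alphabet) / σ.L

/-- The optimal broadcast cost `Δ*` of an instance. -/
def optimalCost (Λ : Instance F K d m m') : ℝ :=
  ⨅ σ : AchievableScheme Λ, σ.cost

/-- Costs are nonnegative, so the infimum is over a set that is bounded below. -/
theorem AchievableScheme.cost_nonneg [Finite F] {Λ : Instance F K d m m'}
    (σ : AchievableScheme Λ) : 0 ≤ σ.cost := by
  haveI : Nonempty σ.Alphabet := ⟨σ.encode 0⟩
  refine div_nonneg (Real.logb_nonneg ?_ ?_) (Nat.cast_nonneg _)
  · exact_mod_cast Finite.one_lt_card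
  · exact_mod_cast Fintype.card_pos

/-- Broadcasting the data itself is achievable, so the infimum is over a nonempty set. -/
theorem nonempty_achievableScheme [Finite F] (Λ : Instance F K d m m') :
    Nonempty (AchievableScheme Λ) := by
  haveI := Fintype.ofFinite F
  classical
  exact ⟨{ L := 1, L_pos := one_pos, Alphabet := Matrix (Fin d) (Fin 1) F
           encode := id, decode := fun k x _ => x.transpose * Λ.demand k
           correct := fun _ _ => rfl }⟩

end LCBC

/-- The probability that a uniformly random instance over `𝔽_{p^n}` satisfies `P`. -/
def LCBC.prob (p : ℕ) [Fact p.Prime] (n K d : ℕ) (m m' : Fin K → ℕ)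
    (P : LCBC.Instance (GaloisField p n) K d m m' → Prop) : ℝ :=
  (Nat.card {Λ : LCBC.Instance (GaloisField p n) K d m m' // P Λ} : ℝ) /
    (Nat.card (LCBC.Instance (GaloisField p n) K d m m') : ℝ)

/-- `Δg` is the generic optimal broadcast cost (that is, it exists and has this value): the optimal
cost of a uniformly random instance over `𝔽_{p^n}` converges to `Δg` in probability as `n → ∞`. -/
def LCBC.IsGenericCost (p : ℕ) [Fact p.Prime] (K d : ℕ) (m m' : Fin K → ℕ) (Δg : ℝ) : Prop :=
  ∀ ε : ℝ, 0 < ε →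
    Tendsto (fun n : ℕ => LCBC.prob p n K d m m' fun Λ => |LCBC.optimalCost Λ - Δg| < ε)
      atTop (𝓝 1)

/-- `C` is the generic capacity, the reciprocal of the generic optimal broadcast cost
(`∞` if that cost is `0`). -/
def LCBC.IsGenericCapacity (p : ℕ) [Fact p.Prime] (K d : ℕ) (m m' : Fin K → ℕ)
    (C : ENNReal) : Prop :=
  ∃ Δg : ℝ, LCBC.IsGenericCost p K d m m' Δg ∧ C = (ENNReal.ofReal Δg)⁻¹

end

/-! Lower bounds. If the users in a set `T` of size `t` are handed the broadcast and all their side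
information, they recover every product of the data with their matrices. When some `r × r` minor of
those matrices is nonzero, this pins down `r` coordinates of each data vector, so the cost is at
least `r - t * m'` (`le_optimalCost`). A fixed minor is a nonzero polynomial over the prime field,
so by Schwartz–Zippel it is nonzero with probability tending to 1 (`whp_det_minor_ne_zero`). Taking
`t` to be the floor or the ceiling of `d / (m + m')` gives the two bounds of part 4.

Upper bounds. Sending `d - m'` coordinates, or all demands, settles parts 1 to 3. The bound `m * d /
(m + m')` comes from interference alignment over the prime field `k`. By additivity take side
information zero and let `y` be a user's demand. After a random shear `R` of the side information,
all `m + m'` entries of `y [1 R]` are combinations of the data coordinates whose coefficients are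
matrix entries. Broadcast `φ (x_i * μ)` for a nonzero `k`-linear `φ` and all monomials `μ` in the
sheared entries with exponents at most `η`. Multiplying a monomial with exponents below `η` by an
entry stays in this family, so every user learns `(m + m') * η ^ W` functionals of `y`, `W` being
the number of entries. They are generically independent if `η ^ W ≈ c * n` with `c` just below `m /
(m + m')`; the little that remains of `y` is sent separately. Since `(η + 1) ^ W ∼ η ^ W`, the cost
tends to `d * c` plus a small error. -/

namespace LCBC

/-! ### Events of probability tending to 1. -/

section Probability

variable {p : ℕ} [Fact p.Prime] {K d : ℕ} {m m' : Fin K → ℕ}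

/-- The sequence of events `P n` holds with probability tending to `1` as `n → ∞`. -/
def Whp (p : ℕ) [Fact p.Prime] (K d : ℕ) (m m' : Fin K → ℕ)
    (P : ∀ n, Instance (GaloisField p n) K d m m' → Prop) : Prop :=
  Tendsto (fun n => prob p n K d m m' (P n)) atTop (𝓝 1)

instance (F : Type) [Zero F] : Nonempty (Instance F K d m m') :=
  ⟨⟨fun _ => 0, fun _ => 0⟩⟩

theorem natCard_instance_pos (n : ℕ) :
    (0 : ℝ) < Nat.card (Instance (GaloisField p n) K d m m') := by
  exact_mod_cast Nat.card_pos

theorem prob_le_one (n : ℕ) (P : Instance (GaloisField p n) K d m m' → Prop) :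
    prob p n K d m m' P ≤ 1 := by
  unfold prob
  rw [div_le_one (natCard_instance_pos n)]
  exact_mod_cast Finite.card_subtype_le P

theorem prob_mono (n : ℕ) {P Q : Instance (GaloisField p n) K d m m' → Prop}
    (h : ∀ Λ, P Λ → Q Λ) : prob p n K d m m' P ≤ prob p n K d m m' Q := by
  unfold prob
  gcongr
  exact Nat.card_le_card_of_injective (Subtype.map id h) (Subtype.map_injective h Function.injective_id)

theorem prob_not (n : ℕ) (P : Instance (GaloisField p n) K d m m' → Prop) :
    prob p n K d m m' (fun Λ => ¬ P Λ) = 1 - prob p n K d m m' P := by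
  classical
  have := natCard_instance_pos (p := p) (K := K) (d := d) (m := m) (m' := m') n
  unfold prob
  rw [eq_sub_iff_add_eq, ← add_div, div_eq_one_iff_eq this.ne', add_comm, ← Nat.cast_add,
    ← Nat.card_sum, Nat.card_congr (Equiv.sumCompl P)]

theorem prob_or_le (n : ℕ) (P Q : Instance (GaloisField p n) K d m m' → Prop) :
    prob p n K d m m' (fun Λ => P Λ ∨ Q Λ) ≤ prob p n K d m m' P + prob p n K d m m' Q := by
  classical
  unfold prob
  rw [← add_div, ← Nat.cast_add, ← Nat.card_sum]
  gcongr
  exact Finite.card_le_of_embedding (subtypeOrLeftEmbedding P Q)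

variable {P Q : ∀ n, Instance (GaloisField p n) K d m m' → Prop}

theorem Whp.mono (hP : Whp p K d m m' P) (h : ∀ᶠ n in atTop, ∀ Λ, P n Λ → Q n Λ) :
    Whp p K d m m' Q :=
  tendsto_of_tendsto_of_tendsto_of_le_of_le' hP tendsto_const_nhds
    (h.mono fun n hn => prob_mono n hn) (Eventually.of_forall fun n => prob_le_one n _)

theorem whp_of_prob_not_le {b : ℕ → ℝ} (hb : Tendsto b atTop (𝓝 0))
    (h : ∀ᶠ n in atTop, prob p n K d m m' (fun Λ => ¬ P n Λ) ≤ b n) : Whp p K d m m' P := by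
  have hb' : Tendsto (fun n => 1 - b n) atTop (𝓝 1) := by simpa using hb.const_sub 1
  refine tendsto_of_tendsto_of_tendsto_of_le_of_le' hb' tendsto_const_nhds ?_
    (Eventually.of_forall fun n => prob_le_one n _)
  filter_upwards [h] with n hn
  rw [prob_not] at hn
  linarith

theorem Whp.prob_not_tendsto (hP : Whp p K d m m' P) :
    Tendsto (fun n => prob p n K d m m' (fun Λ => ¬ P n Λ)) atTop (𝓝 0) := by
  simp_rw [prob_not]
  simpa using Tendsto.const_sub 1 hP

theorem Whp.and (hP : Whp p K d m m' P) (hQ : Whp p K d m m' Q) :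
    Whp p K d m m' (fun n Λ => P n Λ ∧ Q n Λ) := by
  refine whp_of_prob_not_le (by simpa using hP.prob_not_tendsto.add hQ.prob_not_tendsto)
    (Eventually.of_forall fun n => ?_)
  refine le_trans (prob_mono n fun Λ h => ?_) (prob_or_le n _ _)
  tauto

theorem Whp.eventually_exists (hP : Whp p K d m m' P) : ∀ᶠ n in atTop, ∃ Λ, P n Λ := by
  filter_upwards [hP.eventually_ne one_ne_zero] with n hn
  by_contra! h
  refine hn ?_
  have : IsEmpty {Λ // P n Λ} := ⟨fun x => h x.1 x.2⟩
  simp [prob]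

theorem whp_of_forall (h : ∀ᶠ n in atTop, ∀ Λ, P n Λ) : Whp p K d m m' P := by
  refine whp_of_prob_not_le tendsto_const_nhds (h.mono fun n hn => ?_)
  have : IsEmpty {Λ // ¬ P n Λ} := ⟨fun x => x.2 (hn x.1)⟩
  simp [prob]

theorem whp_forall {ι : Type*} [Finite ι]
    {P : ι → ∀ n, Instance (GaloisField p n) K d m m' → Prop}
    (h : ∀ i, Whp p K d m m' (P i)) : Whp p K d m m' (fun n Λ => ∀ i, P i n Λ) := by
  suffices H : ∀ s : Set ι, s.Finite → Whp p K d m m' (fun n Λ => ∀ i ∈ s, P i n Λ) by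
    simpa using H Set.univ Set.finite_univ
  intro s hs
  induction s, hs using Set.Finite.induction_on with
  | empty => exact whp_of_forall (by simp)
  | insert _ _ ih => simpa using (h _).and ih

end Probability

/-! ### Schwartz–Zippel as a count of zeros. -/

section SchwartzZippel

theorem card_zeros_mul_card_le {σ F : Type*} [Fintype σ] [Field F] [Finite F]
    {P : MvPolynomial σ F} (hP : P ≠ 0) :
    Nat.card {w : σ → F // MvPolynomial.eval w P = 0} * Nat.card F ≤
      P.totalDegree * Nat.card (σ → F) := by
  classical
  have := Fintype.ofFinite F
  let e := Fintype.equivFin σ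
  have hP' : MvPolynomial.rename e P ≠ 0 := by
    rwa [Ne, map_eq_zero_iff _ (MvPolynomial.rename_injective _ e.injective)]
  have h := MvPolynomial.schwartz_zippel_totalDegree hP' (Finset.univ : Finset F)
  have h1 : Nat.card {w : σ → F // MvPolynomial.eval w P = 0} =
      Finset.card {f ∈ Fintype.piFinset fun _ : Fin (Fintype.card σ) => (Finset.univ : Finset F) |
        MvPolynomial.eval f (MvPolynomial.rename e P) = 0} := by
    rw [Nat.card_eq_fintype_card, Fintype.card_subtype]
    refine Finset.card_bij' (fun w _ => w ∘ e.symm) (fun w _ => w ∘ e) ?_ ?_ ?_ ?_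
    · intro w hw; simpa [MvPolynomial.eval_rename, Function.comp_assoc] using hw
    · intro w hw; simpa [MvPolynomial.eval_rename] using hw
    · intro w _; ext; simp
    · intro w _; ext; simp
  rw [← h1, div_le_div_iff₀ (pow_pos (by simp [Fintype.card_pos]) _) (by simp [Fintype.card_pos])] at h
  have h2 : Nat.card (σ → F) = (Finset.univ : Finset F).card ^ Fintype.card σ := by
    simp [Nat.card_eq_fintype_card]
  rw [h2, Nat.card_eq_fintype_card (α := F)]
  exact (show _ from by exact_mod_cast h : _ ≤ _).trans
    (Nat.mul_le_mul_right _ (MvPolynomial.totalDegree_rename_le _ _))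

end SchwartzZippel

/-! ### Genericity of polynomial conditions on the entries. -/

section Entries

/-- Positions of the entries of the matrices `[v_k, v_k']` of a symmetric instance. -/
abbrev Coord (K d m m' : ℕ) : Type := Fin d × Fin K × (Fin m ⊕ Fin m')

variable {F : Type} {K d m m' : ℕ}

/-- All the entries of a symmetric instance. -/
def Instance.entry (Λ : Instance F K d (fun _ => m) (fun _ => m')) : Coord K d m m' → F :=
  fun c => Sum.elim (Λ.demand c.2.1 c.1) (Λ.side c.2.1 c.1) c.2.2

/-- A symmetric instance is the same as the family of its entries. -/
def entryEquiv (F : Type) (K d m m' : ℕ) :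
    Instance F K d (fun _ => m) (fun _ => m') ≃ (Coord K d m m' → F) where
  toFun := Instance.entry
  invFun w := ⟨fun k => .of fun i j => w (i, k, .inl j), fun k => .of fun i j => w (i, k, .inr j)⟩
  left_inv _ := rfl
  right_inv w := by
    ext ⟨i, k, j | j⟩ <;> rfl

theorem prob_eq (p : ℕ) [Fact p.Prime] (n : ℕ) (P : (Coord K d m m' → GaloisField p n) → Prop) :
    prob p n K d (fun _ => m) (fun _ => m') (fun Λ => P Λ.entry) =
      (Nat.card {w // P w} : ℝ) / Nat.card (Coord K d m m' → GaloisField p n) := by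
  unfold prob
  rw [Nat.card_congr (entryEquiv (GaloisField p n) K d m m'),
    Nat.card_congr ((entryEquiv (GaloisField p n) K d m m').subtypeEquiv
      (p := fun Λ => P Λ.entry) (q := P) fun _ => Iff.rfl)]

/-- The polynomial is fixed over the prime field, so its degree stays bounded while the field size
`p ^ n` grows. -/
theorem whp_aeval_entry_ne_zero (p : ℕ) [Fact p.Prime] {P : MvPolynomial (Coord K d m m') (ZMod p)}
    (hP : P ≠ 0) :
    Whp p K d (fun _ => m) (fun _ => m') (fun _ Λ => MvPolynomial.aeval Λ.entry P ≠ 0) := by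
  have hp1 : 1 < (p : ℝ) := by exact_mod_cast (Fact.out : p.Prime).one_lt
  have hb : Tendsto (fun n : ℕ => (P.totalDegree : ℝ) / (p : ℝ) ^ n) atTop (𝓝 0) :=
    tendsto_const_nhds.div_atTop (tendsto_pow_atTop_atTop_of_one_lt hp1)
  -- `n = 0` is excluded because `GaloisField p 0` does not have `p ^ 0` elements.
  refine whp_of_prob_not_le hb ((eventually_ne_atTop 0).mono fun n hn => ?_)
  simp only [not_not]
  rw [prob_eq p n (fun w => MvPolynomial.aeval w P = 0)]
  set F := GaloisField p n
  have hP' : MvPolynomial.map (algebraMap (ZMod p) F) P ≠ 0 := by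
    rwa [Ne, map_eq_zero_iff _ (MvPolynomial.map_injective _ (algebraMap (ZMod p) F).injective)]
  have h := card_zeros_mul_card_le hP'
  have h3 : (MvPolynomial.map (algebraMap (ZMod p) F) P).totalDegree ≤ P.totalDegree :=
    Finset.sup_mono (MvPolynomial.support_map_subset _ _)
  simp only [MvPolynomial.eval_map, ← MvPolynomial.aeval_def] at h
  have hc : Nat.card F = p ^ n := GaloisField.card p n hn
  rw [hc] at h
  rw [div_le_div_iff₀ (by exact_mod_cast Nat.card_pos) (by positivity)]
  exact_mod_cast h.trans (Nat.mul_le_mul_right _ h3)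

/-- The submatrix of the `d × K(m+m')` matrix of all entries with given rows and columns. -/
def Instance.minor (Λ : Instance F K d (fun _ => m) (fun _ => m')) {r : ℕ} (ρ : Fin r → Fin d)
    (γ : Fin r → Fin K × (Fin m ⊕ Fin m')) : Matrix (Fin r) (Fin r) F :=
  .of fun i j => Λ.entry (ρ i, γ j)

theorem whp_det_minor_ne_zero (p : ℕ) [Fact p.Prime] {r : ℕ} {ρ : Fin r → Fin d}
    (hρ : Function.Injective ρ) {γ : Fin r → Fin K × (Fin m ⊕ Fin m')}
    (hγ : Function.Injective γ) :
    Whp p K d (fun _ => m) (fun _ => m') (fun _ Λ => (Λ.minor ρ γ).det ≠ 0) := by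
  classical
  let A : Matrix (Fin r) (Fin r) (MvPolynomial (Coord K d m m') (ZMod p)) :=
    .of fun i j => MvPolynomial.X (ρ i, γ j)
  have hA : A.det ≠ 0 := by
    -- Setting the variables at the positions `(ρ i, γ i)` to 1 and all others to 0 turns `A` into
    -- the identity matrix.
    intro h
    have h1 := congrArg (MvPolynomial.eval fun c : Coord K d m m' =>
      if ∃ i, c = (ρ i, γ i) then (1 : ZMod p) else 0) h
    rw [RingHom.map_det, map_zero] at h1
    have h2 : (MvPolynomial.eval fun c : Coord K d m m' =>
      if ∃ i, c = (ρ i, γ i) then (1 : ZMod p) else 0).mapMatrix A = 1 := by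
      ext i j
      simp only [A, RingHom.mapMatrix_apply, Matrix.map_apply, Matrix.of_apply,
        MvPolynomial.eval_X, Matrix.one_apply, Prod.mk.injEq]
      congr 1
      refine propext ⟨?_, fun h => ⟨i, rfl, by rw [h]⟩⟩
      rintro ⟨l, h1, h2⟩
      rw [hρ h1, hγ h2]
    rw [h2, Matrix.det_one] at h1
    exact one_ne_zero h1
  refine (whp_aeval_entry_ne_zero p hA).mono (Eventually.of_forall fun n Λ h => ?_)
  convert h using 1
  rw [AlgHom.map_det]
  congr 1
  ext i j
  simp [A, Instance.minor]

end Entries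

end LCBC

namespace LCBC

/-! ### Single-instance bounds on the optimal cost. -/

section Cost

variable {F : Type} [Field F] [Finite F] {K d : ℕ} {m m' : Fin K → ℕ}

theorem bddBelow_cost (Λ : Instance F K d m m') :
    BddBelow (Set.range fun σ : AchievableScheme Λ => σ.cost) :=
  ⟨0, by rintro _ ⟨σ, rfl⟩; exact σ.cost_nonneg⟩

theorem optimalCost_nonneg (Λ : Instance F K d m m') : 0 ≤ optimalCost Λ :=
  Real.iInf_nonneg fun σ => σ.cost_nonneg

/-- An encoder of a single data vector from which, together with its side information, every user's
demand is determined bounds the optimal cost. -/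
theorem optimalCost_le_logb (Λ : Instance F K d m m') {B : Type} [Finite B]
    (enc : (Fin d → F) → B)
    (h : ∀ x y k, enc x = enc y → Matrix.vecMul x (Λ.side k) = Matrix.vecMul y (Λ.side k) →
      Matrix.vecMul x (Λ.demand k) = Matrix.vecMul y (Λ.demand k)) :
    optimalCost Λ ≤ Real.logb (Nat.card F) (Nat.card B) := by
  classical
  have := Fintype.ofFinite B
  let σ : AchievableScheme Λ :=
    { L := 1
      L_pos := one_pos
      Alphabet := B
      encode := fun x => enc fun i => x i 0
      -- Any data vector consistent with the received symbol and the side information yields the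
      -- right demand.
      decode := fun k s z => if h : ∃ x : Matrix (Fin d) (Fin 1) F,
          enc (fun i => x i 0) = s ∧ x.transpose * Λ.side k = z
        then h.choose.transpose * Λ.demand k else 0
      correct := by
        intro x k
        have hx : ∃ y : Matrix (Fin d) (Fin 1) F, enc (fun i => y i 0) = enc (fun i => x i 0) ∧
          y.transpose * Λ.side k = x.transpose * Λ.side k := ⟨x, rfl, rfl⟩
        rw [dif_pos hx]
        obtain ⟨h1, h2⟩ := hx.choose_spec
        have h3 := h _ _ k h1 (funext fun j => congrFun (congrFun h2 0) j)
        ext a j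
        rw [Subsingleton.elim a 0]
        exact congrFun h3 j }
  refine (ciInf_le (bddBelow_cost Λ) σ).trans ?_
  simp [AchievableScheme.cost, σ]

/-- An additive encoder works if its kernel is compatible with the side information. -/
theorem optimalCost_le_logb_of_addMonoidHom (Λ : Instance F K d m m') {B : Type} [AddCommGroup B]
    [Finite B] (enc : (Fin d → F) →+ B)
    (h : ∀ x k, enc x = 0 → Matrix.vecMul x (Λ.side k) = 0 → Matrix.vecMul x (Λ.demand k) = 0) :
    optimalCost Λ ≤ Real.logb (Nat.card F) (Nat.card B) := by
  refine optimalCost_le_logb Λ enc fun x y k h1 h2 => ?_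
  rw [← sub_eq_zero, ← Matrix.sub_vecMul] at h2 ⊢
  exact h _ k (by rw [map_sub, h1, sub_self]) h2

theorem logb_card_pow (r : ℕ) : Real.logb (Nat.card F) ((Nat.card F : ℝ) ^ r) = r := by
  have h1 : 1 < (Nat.card F : ℝ) := by exact_mod_cast Finite.one_lt_card
  rw [Real.logb_pow, Real.logb_self_eq_one h1, mul_one]

/-- Side information of the users in `T`, added to the broadcast, reveals their demands; so the
cost is at least the rank of their matrices minus the size of their side information. -/
theorem le_optimalCost {m m' : ℕ} (Λ : Instance F K d (fun _ => m) (fun _ => m')) {r : ℕ}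
    (T : Finset (Fin K)) (ρ : Fin r → Fin d) (γ : Fin r → Fin K × (Fin m ⊕ Fin m'))
    (hγ : ∀ i, (γ i).1 ∈ T) (hdet : (Λ.minor ρ γ).det ≠ 0) :
    (r : ℝ) - T.card * m' ≤ optimalCost Λ := by
  classical
  have := Fintype.ofFinite F
  have := nonempty_achievableScheme Λ
  refine le_ciInf fun σ => ?_
  -- Only data supported on the rows `ρ` are used; on these the minor alone governs injectivity.
  let E : Matrix (Fin d) (Fin r) F := .of fun i j => if i = ρ j then 1 else 0
  have hE : ∀ {n : ℕ} (A : Matrix (Fin d) (Fin n) F) (z : Matrix (Fin r) (Fin σ.L) F) l j,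
      ((E * z).transpose * A) l j = ∑ i, z i l * A (ρ i) j := by
    intro n A z l j
    rw [Matrix.transpose_mul, Matrix.mul_assoc, Matrix.mul_apply]
    simp [E, Matrix.mul_apply]
  let f : Matrix (Fin r) (Fin σ.L) F → σ.Alphabet × (T → Matrix (Fin σ.L) (Fin m') F) :=
    fun z => (σ.encode (E * z), fun k => (E * z).transpose * Λ.side k)
  have hf : Function.Injective f := by
    intro z z' h
    obtain ⟨h1, h2⟩ := Prod.mk.inj h
    have hs : ∀ k ∈ T, (E * z).transpose * Λ.side k = (E * z').transpose * Λ.side k :=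
      fun k hk => congrFun h2 ⟨k, hk⟩
    have hd : ∀ k ∈ T, (E * z).transpose * Λ.demand k = (E * z').transpose * Λ.demand k := by
      intro k hk
      rw [← σ.correct, ← σ.correct, h1, hs k hk]
    have hm : z.transpose * Λ.minor ρ γ = z'.transpose * Λ.minor ρ γ := by
      ext l j
      have hT := hγ j
      simp only [Matrix.mul_apply, Matrix.transpose_apply, Instance.minor, Matrix.of_apply,
        Instance.entry]
      rcases (γ j).2 with c | c
      · simpa only [hE, Sum.elim_inl] using congrFun (congrFun (hd _ hT) l) c
      · simpa only [hE, Sum.elim_inr] using congrFun (congrFun (hs _ hT) l) c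
    have hm' := congrArg (· * (Λ.minor ρ γ)⁻¹) hm
    simp only [Matrix.mul_nonsing_inv_cancel_right _ _ hdet.isUnit] at hm'
    exact Matrix.transpose_injective hm'
  have hcard := Nat.card_le_card_of_injective f hf
  have hL : (0 : ℝ) < σ.L := by exact_mod_cast σ.L_pos
  have : Nonempty σ.Alphabet := ⟨σ.encode 0⟩
  have hq : 1 < (Nat.card F : ℝ) := by exact_mod_cast Finite.one_lt_card
  have hA : (0 : ℝ) < Fintype.card σ.Alphabet := by exact_mod_cast Fintype.card_pos
  have hcard' : (Nat.card F : ℝ) ^ (r * σ.L) ≤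
      Fintype.card σ.Alphabet * (Nat.card F : ℝ) ^ (T.card * σ.L * m') := by
    have e1 : Nat.card (Matrix (Fin r) (Fin σ.L) F) = Nat.card F ^ (r * σ.L) := by
      simp [Matrix, ← pow_mul, mul_comm]
    have e2 : Nat.card (T → Matrix (Fin σ.L) (Fin m') F) =
        Nat.card F ^ (T.card * σ.L * m') := by
      simp [Matrix, ← pow_mul, mul_comm, mul_left_comm]
    rw [Nat.card_prod, e1, e2, Nat.card_eq_fintype_card (α := σ.Alphabet)] at hcard
    exact_mod_cast hcard
  have hlog := Real.logb_le_logb_of_le hq (by positivity) hcard'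
  rw [Real.logb_mul hA.ne' (by positivity), logb_card_pow, logb_card_pow] at hlog
  rw [AchievableScheme.cost, le_div_iff₀ hL]
  push_cast at hlog
  linarith

end Cost

/-! ### Generic lower bounds and the elementary schemes. -/

section Generic

variable (p : ℕ) [Fact p.Prime] {K d m m' : ℕ}

theorem whp_le_optimalCost {t r : ℕ} (ht : t ≤ K) (hr : r ≤ d) (hr' : r ≤ t * (m + m')) :
    Whp p K d (fun _ => m) (fun _ => m') fun _ Λ => (r : ℝ) - t * m' ≤ optimalCost Λ := by
  let e : Fin (t * (m + m')) ≃ Fin t × (Fin m ⊕ Fin m') :=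
    finProdFinEquiv.symm.trans (Equiv.prodCongr (Equiv.refl _) finSumFinEquiv.symm)
  let γ : Fin r → Fin K × (Fin m ⊕ Fin m') :=
    fun i => Prod.map (Fin.castLE ht) id (e (Fin.castLE hr' i))
  have hγ : Function.Injective γ :=
    ((Fin.castLE_injective ht).prodMap Function.injective_id).comp
      (e.injective.comp (Fin.castLE_injective hr'))
  refine (whp_det_minor_ne_zero p (Fin.castLE_injective hr) hγ).mono
    (Eventually.of_forall fun n Λ h => ?_)
  have := le_optimalCost Λ (Finset.univ.map (Fin.castLEEmb ht)) _ γ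
    (fun i => by simp [γ]) h
  simpa using this

/-- The first `r` coordinates are broadcast; each user solves for the other `d - r ≤ m'` from the
first `d - r` columns of its side information. -/
theorem optimalCost_le_of_side_minor {F : Type} [Field F] [Finite F] {r : ℕ}
    (Λ : Instance F K d (fun _ => m) (fun _ => m')) (hr : r ≤ d) (hr' : d ≤ m' + r)
    (h : ∀ k : Fin K, (Λ.minor (fun i : Fin (d - r) => (⟨r + i, by omega⟩ : Fin d))
      (fun j => (k, .inr ⟨j, by omega⟩))).det ≠ 0) :
    optimalCost Λ ≤ r := by
  let enc : (Fin d → F) →+ (Fin r → F) :=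
    (LinearMap.funLeft F F (Fin.castLE hr)).toAddMonoidHom
  have := optimalCost_le_logb_of_addMonoidHom Λ enc (fun x k h1 h2 => ?_)
  · rwa [Nat.card_fun, Nat.card_eq_fintype_card (α := Fin r), Fintype.card_fin, Nat.cast_pow,
      logb_card_pow] at this
  have hx : ∀ i : Fin d, i.1 < r → x i = 0 := fun i hi => congrFun h1 ⟨i, hi⟩
  suffices x = 0 by rw [this, Matrix.zero_vecMul]
  have hy := Matrix.eq_zero_of_vecMul_eq_zero (h k)
    (v := fun i : Fin (d - r) => x ⟨r + i, by omega⟩) ?_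
  · ext i
    rcases lt_or_ge i.1 r with hi | hi
    · exact hx i hi
    · have := congrFun hy ⟨i - r, by omega⟩
      simpa [Nat.add_sub_cancel' hi] using this
  ext j
  have h3 := congrFun h2 ⟨j, by omega⟩
  rw [Matrix.vecMul, dotProduct] at h3 ⊢
  rw [Pi.zero_apply] at h3 ⊢
  rw [← h3]
  let ι : Fin (d - r) ↪ Fin d := ⟨fun i => ⟨r + i, by omega⟩, fun a b hab => by
    simpa [Fin.ext_iff] using hab⟩
  rw [← Finset.sum_subset (Finset.subset_univ (Finset.univ.map ι)), Finset.sum_map]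
  · rfl
  · intro i _ hi
    rw [hx i, zero_mul]
    by_contra hir
    exact hi (Finset.mem_map.2 ⟨⟨i - r, by omega⟩, Finset.mem_univ _, Fin.ext (by
      change r + (i.1 - r) = i.1; omega)⟩)

theorem whp_optimalCost_le_of_le {r : ℕ} (hr : r ≤ d) (hr' : d ≤ m' + r) :
    Whp p K d (fun _ => m) (fun _ => m') fun _ Λ => optimalCost Λ ≤ r := by
  refine (whp_forall fun k : Fin K => whp_det_minor_ne_zero p
    (ρ := fun i : Fin (d - r) => (⟨r + i, by omega⟩ : Fin d))
    (γ := fun j => (k, .inr ⟨j, by omega⟩)) ?_ ?_).mono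
    (Eventually.of_forall fun n Λ h => optimalCost_le_of_side_minor Λ hr hr' h)
  · intro a b hab
    simpa [Fin.ext_iff] using hab
  · intro a b hab
    simpa [Fin.ext_iff] using hab

/-- Broadcasting all demands. -/
theorem optimalCost_le_mul {F : Type} [Field F] [Finite F]
    (Λ : Instance F K d (fun _ => m) (fun _ => m')) : optimalCost Λ ≤ K * m := by
  let enc : (Fin d → F) →+ (Fin K → Fin m → F) :=
    AddMonoidHom.mk' (fun x k => Matrix.vecMul x (Λ.demand k))
      (fun x y => funext fun k => Matrix.add_vecMul _ _ _)
  have := optimalCost_le_logb_of_addMonoidHom Λ enc (fun x k h1 _ => congrFun h1 k)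
  simp only [Nat.card_fun, Nat.card_eq_fintype_card (α := Fin _), Fintype.card_fin, ← pow_mul,
    Nat.cast_pow, logb_card_pow] at this
  rw [mul_comm]
  exact_mod_cast this

theorem isGenericCost_of_whp {Δ : ℝ}
    (h1 : Whp p K d (fun _ => m) (fun _ => m') fun _ Λ => Δ ≤ optimalCost Λ)
    (h2 : ∀ ε : ℝ, 0 < ε → Whp p K d (fun _ => m) (fun _ => m') fun _ Λ => optimalCost Λ < Δ + ε) :
    IsGenericCost p K d (fun _ => m) (fun _ => m') Δ := fun ε hε =>
  (h1.and (h2 ε hε)).mono (Eventually.of_forall fun n Λ h => by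
    rw [abs_lt]; constructor <;> linarith [h.1, h.2])

/-- Two events of probability tending to 1 eventually share an instance, and there the bounds can be
compared. -/
theorem IsGenericCost.le {Δ a : ℝ} (h : IsGenericCost p K d (fun _ => m) (fun _ => m') Δ)
    (h1 : Whp p K d (fun _ => m) (fun _ => m') fun _ Λ => a ≤ optimalCost Λ) : a ≤ Δ := by
  refine le_of_forall_pos_lt_add fun ε hε => ?_
  obtain ⟨n, Λ, h2, h3⟩ := (Whp.and (h ε hε) h1).eventually_exists.exists
  linarith [(abs_lt.1 h2).2]

theorem IsGenericCost.ge {Δ a : ℝ} (h : IsGenericCost p K d (fun _ => m) (fun _ => m') Δ)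
    (h1 : ∀ ε : ℝ, 0 < ε → Whp p K d (fun _ => m) (fun _ => m') fun _ Λ => optimalCost Λ < a + ε) :
    Δ ≤ a := by
  refine le_of_forall_pos_lt_add fun ε hε => ?_
  obtain ⟨n, Λ, h2, h3⟩ :=
    (Whp.and (h (ε / 2) (half_pos hε)) (h1 (ε / 2) (half_pos hε))).eventually_exists.exists
  linarith [(abs_lt.1 h2).1]

end Generic

end LCBC

namespace LCBC

/-! ### Polynomials with bounded exponents. -/

section Grid

variable {k F σ : Type} [Field k] [Field F] [Algebra k F] [Fintype σ]

/-- The monomial with exponents `e`, evaluated at `w`. -/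
def gridMonomial (w : σ → F) {η : ℕ} (e : σ → Fin η) : F :=
  ∏ s, w s ^ (e s : ℕ)

/-- The polynomial with coefficients `c` and all exponents below `η`, evaluated at `w`. -/
noncomputable def gridEval (w : σ → F) {η : ℕ} (c : (σ → Fin η) → k) : F := by
  classical exact ∑ e, c e • gridMonomial w e

theorem exists_mul_gridMonomial (w : σ → F) {η : ℕ} (e : σ → Fin η) (s : σ) :
    ∃ e' : σ → Fin (η + 1), w s * gridMonomial w e = gridMonomial w e' := by
  classical
  refine ⟨fun t => ⟨(if t = s then 1 else 0) + e t, by split_ifs <;> omega⟩, ?_⟩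
  simp only [gridMonomial, pow_add, Finset.prod_mul_distrib]
  simp [pow_ite]

theorem card_gridEval_eq_zero_le [Finite F] {η : ℕ} {c : (σ → Fin η) → k} (hc : c ≠ 0) :
    Nat.card {w : σ → F // gridEval w c = 0} * Nat.card F ≤
      (Fintype.card σ * η) * Nat.card (σ → F) := by
  classical
  let ex : (σ → Fin η) → σ →₀ ℕ := fun e => Finsupp.equivFunOnFinite.symm fun s => (e s : ℕ)
  have hex : Function.Injective ex := fun e e' h => by
    ext s
    exact DFunLike.congr_fun h s
  let P : MvPolynomial σ F := ∑ e, MvPolynomial.monomial (ex e) (algebraMap k F (c e))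
  have hP : P ≠ 0 := by
    obtain ⟨e, he⟩ := Function.ne_iff.1 hc
    intro h
    have := congrArg (MvPolynomial.coeff (ex e)) h
    simp only [P, MvPolynomial.coeff_sum, MvPolynomial.coeff_monomial, hex.eq_iff,
      Finset.sum_ite_eq', Finset.mem_univ, if_true, MvPolynomial.coeff_zero] at this
    exact he ((map_eq_zero _).1 this)
  have heval : ∀ w, MvPolynomial.eval w P = gridEval w c := fun w => by
    simp only [P, map_sum, MvPolynomial.eval_monomial, gridEval, gridMonomial, Algebra.smul_def]
    refine Finset.sum_congr rfl fun e _ => ?_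
    rw [Finsupp.prod_fintype _ _ (by simp)]
    rfl
  have hdeg : P.totalDegree ≤ Fintype.card σ * η := by
    refine MvPolynomial.totalDegree_finsetSum_le fun e _ => ?_
    refine (MvPolynomial.totalDegree_monomial_le _ _).trans ?_
    rw [Finsupp.sum_fintype _ _ (by simp)]
    refine (Finset.sum_le_card_nsmul _ _ η fun s _ => (e s).2.le).trans ?_
    simp
  have := card_zeros_mul_card_le hP
  simp only [heval] at this
  exact this.trans (Nat.mul_le_mul_right _ hdeg)

end Grid

/-! ### The interference alignment scheme. -/

section Alignment

variable {k F : Type} [Field k] [Field F] [Algebra k F] {K d m m' : ℕ}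

/-- Adding combinations of the demands to the side information. -/
def Instance.shear (Λ : Instance F K d (fun _ => m) (fun _ => m')) (R : Matrix (Fin m) (Fin m') F) :
    Instance F K d (fun _ => m) (fun _ => m') :=
  ⟨Λ.demand, fun k => Λ.side k + Λ.demand k * R⟩

/-- No nontrivial tuple of polynomials with coefficients in `k` and exponents below `η` has its
values at `w` in the kernel of `[1 R]`. -/
def GridIndependent (k : Type) [Field k] [Algebra k F] {σ : Type} [Fintype σ] (η : ℕ) (w : σ → F)
    (R : Matrix (Fin m) (Fin m') F) : Prop :=
  ∀ c : Fin m ⊕ Fin m' → (σ → Fin η) → k,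
    ((fun i => gridEval w (c (.inl i))) + R.mulVec fun j => gridEval w (c (.inr j))) = 0 → c = 0

/-- The functionals `y ↦ φ (z_j μ)`, for `z = y [1 R]` and monomials `μ`. -/
def gridFunctionals {σ : Type} [Fintype σ] (φ : F →ₗ[k] k) (η : ℕ) (w : σ → F)
    (R : Matrix (Fin m) (Fin m') F) :
    (Fin m → F) →ₗ[k] (Fin m ⊕ Fin m' → (σ → Fin η) → k) where
  toFun y j e := φ (Sum.elim y (Matrix.vecMul y R) j * gridMonomial w e)
  map_add' y z := by
    ext j e
    rcases j with j | j <;> simp [Matrix.add_vecMul, add_mul]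
  map_smul' a y := by
    ext j e
    rcases j with j | j <;> simp [Matrix.smul_vecMul]

/-- Duality: a functional killing the range is a coefficient tuple `c`, and its pullback to `y` is
`φ (y ⬝ᵥ u)` with `u` the value of `[1 R]` on the polynomials of `c`. As `y` is arbitrary and `φ ≠
0`, `u = 0`, so independence forces `c = 0`. -/
theorem gridFunctionals_surjective {σ : Type} [Fintype σ] {φ : F →ₗ[k] k} (hφ : φ ≠ 0) {η : ℕ}
    {w : σ → F} {R : Matrix (Fin m) (Fin m') F} (h : GridIndependent k η w R) :
    Function.Surjective (gridFunctionals φ η w R) := by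
  classical
  rw [← LinearMap.range_eq_top]
  by_contra hlt
  obtain ⟨f, hf0, hf⟩ := Submodule.exists_le_ker_of_lt_top _ (lt_top_iff_ne_top.2 hlt)
  let c : Fin m ⊕ Fin m' → (σ → Fin η) → k := fun j e => f (Pi.single j (Pi.single e 1))
  have hfc : ∀ v, f v = ∑ j, ∑ e, v j e * c j e := by
    intro v
    have hv : v = ∑ j, ∑ e, v j e • Pi.single j (Pi.single e (1 : k)) := by
      ext j e
      rcases j with j | j <;> simp [Finset.sum_apply, Pi.single_apply, ite_apply]
    conv_lhs => rw [hv]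
    simp [c]
  have hc : c = 0 := by
    apply h
    set u := (fun i => gridEval w (c (.inl i))) + R.mulVec fun j => gridEval w (c (.inr j))
      with hu
    have key : ∀ y, φ (y ⬝ᵥ u) = 0 := by
      intro y
      have h0 : f (gridFunctionals φ η w R y) = 0 := hf ⟨y, rfl⟩
      rw [← h0, hfc, hu, dotProduct_add, Matrix.dotProduct_mulVec, dotProduct, dotProduct]
      simp only [Fintype.sum_sum_type, gridFunctionals, LinearMap.coe_mk, AddHom.coe_mk,
        Sum.elim_inl, Sum.elim_inr, gridEval, map_add, map_sum, Finset.mul_sum, mul_smul_comm,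
        map_smul, smul_eq_mul]
      simp only [mul_comm]
    ext i
    by_contra hi
    obtain ⟨t, ht⟩ : ∃ t, φ t ≠ 0 := by
      by_contra! h
      exact hφ (LinearMap.ext h)
    have := key (Pi.single i (t * (u i)⁻¹))
    rw [single_dotProduct, inv_mul_cancel_right₀ hi] at this
    exact ht this
  exact hf0 (LinearMap.ext fun v => by simp [hfc, hc])

/-- With zero side information the sheared side information of a user equals `y R`, so it carries
information about the demand `y` alone. -/
theorem sum_mul_shear_entry (Λ : Instance F K d (fun _ => m) (fun _ => m'))
    (R : Matrix (Fin m) (Fin m') F) {x : Fin d → F} {l : Fin K}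
    (hx : Matrix.vecMul x (Λ.side l) = 0) (j : Fin m ⊕ Fin m') :
    Sum.elim (Matrix.vecMul x (Λ.demand l)) (Matrix.vecMul (Matrix.vecMul x (Λ.demand l)) R) j =
      ∑ i, x i * (Λ.shear R).entry (i, l, j) := by
  rcases j with j | j
  · rfl
  · have : Matrix.vecMul (Matrix.vecMul x (Λ.demand l)) R =
        Matrix.vecMul x (Λ.side l + Λ.demand l * R) := by
      rw [Matrix.vecMul_add, hx, zero_add, Matrix.vecMul_vecMul]
    rw [Sum.elim_inr, this]
    rfl

/-- The interference alignment scheme. -/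
theorem optimalCost_le_of_gridIndependent [Finite k] [Finite F]
    (Λ : Instance F K d (fun _ => m) (fun _ => m')) (R : Matrix (Fin m) (Fin m') F) (η : ℕ)
    (h : GridIndependent k η (Λ.shear R).entry R) :
    optimalCost Λ ≤
      d * (η + 1 : ℝ) ^ Fintype.card (Coord K d m m') * Real.logb (Nat.card F) (Nat.card k) +
      K * (m - (m + m') * (η : ℝ) ^ Fintype.card (Coord K d m m') *
        Real.logb (Nat.card F) (Nat.card k)) := by
  classical
  have := Module.Finite.of_finite (R := k) (M := F)
  obtain ⟨φ, hφ⟩ : ∃ φ : F →ₗ[k] k, φ ≠ 0 := exists_ne 0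
  set w := (Λ.shear R).entry
  let T := gridFunctionals φ η w R
  have hT : Function.Surjective T := gridFunctionals_surjective hφ h
  -- `π` projects onto the part of the demand space that the aligned functionals do not see; the
  -- broadcast includes `π y` for every user.
  obtain ⟨π, hπ⟩ := LinearMap.exists_leftInverse_of_injective T.ker.subtype
    (Submodule.ker_subtype _)
  let enc : (Fin d → F) →+ (Fin d → (Coord K d m m' → Fin (η + 1)) → k) × (Fin K → T.ker) :=
    AddMonoidHom.mk' (fun x => (fun i e => φ (x i * gridMonomial w e),
      fun l => π (Matrix.vecMul x (Λ.demand l)))) (fun x y => by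
        refine Prod.ext ?_ ?_
        · ext i e
          simp [add_mul]
        · ext l
          simp [Matrix.add_vecMul])
  have hle := optimalCost_le_logb_of_addMonoidHom Λ enc (fun x l h1 h2 => ?_)
  · have hF : (1 : ℝ) < Nat.card F := by exact_mod_cast Finite.one_lt_card
    have hk : (1 : ℝ) < Nat.card k := by exact_mod_cast Finite.one_lt_card
    have hker : (Nat.card T.ker : ℝ) *
        (Nat.card k : ℝ) ^ ((m + m') * η ^ Fintype.card (Coord K d m m')) =
        (Nat.card F : ℝ) ^ m := by
      have e1 := AddSubgroup.card_eq_card_quotient_mul_card_addSubgroup T.toAddMonoidHom.ker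
      rw [Nat.card_congr (QuotientAddGroup.quotientKerEquivOfSurjective T.toAddMonoidHom
        hT).toEquiv] at e1
      have e2 : Nat.card (Fin m ⊕ Fin m' → (Coord K d m m' → Fin η) → k) =
          Nat.card k ^ ((m + m') * η ^ Fintype.card (Coord K d m m')) := by
        rw [Nat.card_fun, Nat.card_fun, ← pow_mul, Nat.card_fun]
        simp [mul_comm]
      rw [e2, Nat.card_fun, Nat.card_eq_fintype_card (α := Fin m), Fintype.card_fin] at e1
      rw [mul_comm]
      exact_mod_cast e1.symm
    have hkerpos : (0 : ℝ) < Nat.card T.ker := by exact_mod_cast Nat.card_pos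
    have hlogker : Real.logb (Nat.card F) (Nat.card T.ker) = m - ((m + m') *
        (η : ℝ) ^ Fintype.card (Coord K d m m')) * Real.logb (Nat.card F) (Nat.card k) := by
      have := congrArg (Real.logb (Nat.card F)) hker
      rw [Real.logb_mul hkerpos.ne' (by positivity), Real.logb_pow, logb_card_pow] at this
      push_cast at this
      linarith
    have e3 : Nat.card ((Fin d → (Coord K d m m' → Fin (η + 1)) → k) × (Fin K → T.ker)) =
        Nat.card k ^ (d * (η + 1) ^ Fintype.card (Coord K d m m')) * Nat.card T.ker ^ K := by
      rw [Nat.card_prod, Nat.card_fun, Nat.card_fun, ← pow_mul, Nat.card_fun, Nat.card_fun]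
      simp [mul_comm]
    rw [e3, Nat.cast_mul, Nat.cast_pow, Nat.cast_pow, Real.logb_mul (by positivity)
      (by positivity), Real.logb_pow, Real.logb_pow, hlogker] at hle
    push_cast at hle
    exact hle
  · obtain ⟨h3, h4⟩ := Prod.mk.inj h1
    set y := Matrix.vecMul x (Λ.demand l) with hy
    have hyT : y ∈ T.ker := by
      rw [LinearMap.mem_ker]
      ext j e
      change φ (Sum.elim y (Matrix.vecMul y R) j * gridMonomial w e) = 0
      rw [sum_mul_shear_entry Λ R h2, Finset.sum_mul, map_sum]
      refine Finset.sum_eq_zero fun i _ => ?_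
      -- Alignment: an entry times a monomial with exponents below `η` is a monomial with exponents
      -- below `η + 1`, and these were all broadcast.
      obtain ⟨e', he'⟩ := exists_mul_gridMonomial w e (i, l, j)
      rw [mul_assoc, he']
      exact congrFun (congrFun h3 i) e'
    have h5 := DFunLike.congr_fun hπ ⟨y, hyT⟩
    have h6 : π y = 0 := congrFun h4 l
    change π y = ⟨y, hyT⟩ at h5
    rw [h6] at h5
    exact (congrArg Subtype.val h5).symm

end Alignment

/-! ### Union bounds for the failure of independence. -/

section Counting

theorem card_subtype_le_add {α : Type*} [Finite α] {P A B : α → Prop} (h : ∀ a, P a → A a ∨ B a) :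
    Nat.card {a // P a} ≤ Nat.card {a // A a} + Nat.card {a // B a} := by
  classical
  rw [← Nat.card_sum]
  exact (Nat.card_le_card_of_injective (Subtype.map (q := fun a => A a ∨ B a) id h)
    (Subtype.map_injective _ Function.injective_id)).trans
    (Finite.card_le_of_embedding (subtypeOrLeftEmbedding A B))

theorem card_subtype_fst {α β : Type*} (A : α → Prop) :
    Nat.card {x : α × β // A x.1} = Nat.card {a // A a} * Nat.card β := by
  rw [← Nat.card_prod]
  exact Nat.card_congr ⟨fun x => (⟨x.1.1, x.2⟩, x.1.2), fun x => ⟨(x.1.1, x.2), x.1.2⟩,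
    fun _ => rfl, fun _ => rfl⟩

theorem card_exists_le {α ι : Type*} [Finite α] [Finite ι] (P : ι → α → Prop) {B : ℝ}
    (h : ∀ i, (Nat.card {a // P i a} : ℝ) ≤ B) :
    (Nat.card {a // ∃ i, P i a} : ℝ) ≤ Nat.card ι * B := by
  classical
  have := Fintype.ofFinite ι
  have h1 : Nat.card {a // ∃ i, P i a} ≤ Nat.card (Σ i, {a // P i a}) :=
    Nat.card_le_card_of_injective (fun a => ⟨a.2.choose, a.1, a.2.choose_spec⟩)
      (fun a b hab => Subtype.ext (by
        simp only [Sigma.mk.injEq] at hab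
        obtain ⟨h1, h2⟩ := hab
        have : ∀ {i j : ι} {x : {a // P i a}} {y : {a // P j a}}, i = j → x ≍ y → x.1 = y.1 := by
          rintro i _ x y rfl h
          rw [eq_of_heq h]
        exact this h1 h2))
  rw [Nat.card_sigma] at h1
  calc (Nat.card {a // ∃ i, P i a} : ℝ) ≤ ∑ i, (Nat.card {a // P i a} : ℝ) := by exact_mod_cast h1
    _ ≤ ∑ _i : ι, B := Finset.sum_le_sum fun i _ => h i
    _ = Nat.card ι * B := by simp

variable {k F σ : Type} [Field k] [Field F] [Algebra k F] [Fintype σ] [Finite F] {m m' : ℕ}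

/-- Pick `j` with `g j ≠ 0`. Adding a vector `v` to column `j` of a solution `R` changes the value
from 0 to `g j • v`, so `v` and then `R` can be read off the sum. -/
theorem card_add_mulVec_eq_zero_mul_le (a : Fin m → F) {g : Fin m' → F} (hg : g ≠ 0) :
    Nat.card {R : Matrix (Fin m) (Fin m') F // a + R.mulVec g = 0} * Nat.card F ^ m ≤
      Nat.card (Matrix (Fin m) (Fin m') F) := by
  classical
  obtain ⟨j, hj⟩ := Function.ne_iff.1 hg
  have e : Nat.card (Fin m → F) = Nat.card F ^ m := by simp [Nat.card_fun]
  rw [← e, ← Nat.card_prod]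
  let f : {R : Matrix (Fin m) (Fin m') F // a + R.mulVec g = 0} × (Fin m → F) →
      Matrix (Fin m) (Fin m') F := fun x => x.1.1 + Matrix.vecMulVec x.2 (Pi.single j 1)
  have hf : ∀ x, a + (f x).mulVec g = g j • x.2 := fun x => by
    rw [Matrix.add_mulVec, ← add_assoc, x.1.2, zero_add, Matrix.vecMulVec_mulVec]
    ext i
    simp [mul_comm]
  refine Nat.card_le_card_of_injective f fun x y hxy => ?_
  have h2 : x.2 = y.2 := smul_right_injective _ hj (by
    change g j • x.2 = g j • y.2
    rw [← hf, ← hf, hxy])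
  refine Prod.ext (Subtype.ext ?_) h2
  have h3 : x.1.1 + Matrix.vecMulVec x.2 (Pi.single j 1) =
    y.1.1 + Matrix.vecMulVec y.2 (Pi.single j 1) := hxy
  rw [h2] at h3
  exact add_right_cancel h3

theorem card_not_gridIndependent_le [Finite k] (η : ℕ) :
    (Nat.card {x : (σ → F) × Matrix (Fin m) (Fin m') F // ¬ GridIndependent k η x.1 x.2} : ℝ) ≤
      ((Nat.card k : ℝ) ^ (η ^ Fintype.card σ) * (Fintype.card σ * η) / Nat.card F +
        (Nat.card k : ℝ) ^ ((m + m') * η ^ Fintype.card σ) / (Nat.card F : ℝ) ^ m) *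
      (Nat.card (σ → F) * Nat.card (Matrix (Fin m) (Fin m') F)) := by
  classical
  have hF : (0 : ℝ) < Nat.card F := by exact_mod_cast Nat.card_pos
  -- Independence fails only if a nonzero polynomial vanishes at `w` (event `A`, independent of
  -- `R`), or if a tuple has nonzero side part and `R` satisfies the resulting linear equation
  -- (event `B`).
  let A : (σ → F) → Prop := fun w => ∃ c : (σ → Fin η) → k, c ≠ 0 ∧ gridEval w c = 0
  let B : (σ → F) × Matrix (Fin m) (Fin m') F → Prop := fun x =>
    ∃ c : Fin m ⊕ Fin m' → (σ → Fin η) → k, (fun j => gridEval x.1 (c (.inr j))) ≠ 0 ∧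
      ((fun i => gridEval x.1 (c (.inl i))) + x.2.mulVec fun j => gridEval x.1 (c (.inr j))) = 0
  have hsub : ∀ x : (σ → F) × Matrix (Fin m) (Fin m') F,
      ¬ GridIndependent k η x.1 x.2 → A x.1 ∨ B x := by
    rintro ⟨w, R⟩ hx
    by_contra! hAB
    obtain ⟨hA, hB⟩ := hAB
    have hA' : ∀ c : (σ → Fin η) → k, gridEval w c = 0 → c = 0 := fun c hc => by
      by_contra hne
      exact hA ⟨c, hne, hc⟩
    refine hx fun c hc => ?_
    have h1 : (fun j => gridEval w (c (.inr j))) = 0 := by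
      by_contra hne
      exact hB ⟨c, hne, hc⟩
    simp only at hc
    rw [h1, Matrix.mulVec_zero, add_zero] at hc
    ext1 j
    rcases j with j | j
    · exact hA' _ (congrFun hc j)
    · exact hA' _ (congrFun h1 j)
  have hAcard : (Nat.card {w // A w} : ℝ) ≤ (Nat.card k : ℝ) ^ (η ^ Fintype.card σ) *
      ((Fintype.card σ * η) * Nat.card (σ → F) / Nat.card F) := by
    have h1 : ((Nat.card k : ℝ) ^ (η ^ Fintype.card σ)) = Nat.card ((σ → Fin η) → k) := by
      rw [Nat.card_fun, Nat.card_fun]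
      simp
    rw [h1]
    refine card_exists_le _ fun c => ?_
    by_cases hc : c = 0
    · have : IsEmpty {w : σ → F // c ≠ 0 ∧ gridEval w c = 0} := ⟨fun x => x.2.1 hc⟩
      rw [Nat.card_of_isEmpty, Nat.cast_zero]
      positivity
    · simp only [ne_eq, hc, not_false_eq_true, true_and]
      rw [le_div_iff₀ hF]
      exact_mod_cast card_gridEval_eq_zero_le hc
  have hBcard : (Nat.card {x // B x} : ℝ) ≤ (Nat.card k : ℝ) ^ ((m + m') * η ^ Fintype.card σ) *
      (Nat.card (σ → F) * Nat.card (Matrix (Fin m) (Fin m') F) / (Nat.card F : ℝ) ^ m) := by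
    have h1 : (Nat.card k : ℝ) ^ ((m + m') * η ^ Fintype.card σ) =
        Nat.card (Fin m ⊕ Fin m' → (σ → Fin η) → k) := by
      rw [Nat.card_fun, Nat.card_fun, ← pow_mul, Nat.card_fun]
      simp [mul_comm]
    rw [h1]
    refine card_exists_le _ fun c => ?_
    have := Fintype.ofFinite F
    rw [Nat.card_congr (Equiv.subtypeProdEquivSigmaSubtype
      (fun (w : σ → F) (R : Matrix (Fin m) (Fin m') F) =>
        (fun j => gridEval w (c (.inr j))) ≠ 0 ∧
        ((fun i => gridEval w (c (.inl i))) + R.mulVec fun j => gridEval w (c (.inr j))) = 0)),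
      Nat.card_sigma, Nat.cast_sum, mul_div_assoc]
    refine (Finset.sum_le_card_nsmul _ _ ((Nat.card (Matrix (Fin m) (Fin m') F) : ℝ) /
      (Nat.card F : ℝ) ^ m) fun w _ => ?_).trans (by simp)
    by_cases hg : (fun j => gridEval w (c (.inr j))) = 0
    · simp only [hg, ne_eq, not_true_eq_false, false_and]
      rw [Nat.card_of_isEmpty, Nat.cast_zero]
      positivity
    · simp only [ne_eq, hg, not_false_eq_true, true_and]
      rw [le_div_iff₀ (by positivity)]
      exact_mod_cast card_add_mulVec_eq_zero_mul_le _ hg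
  have h1 : Nat.card {x : (σ → F) × Matrix (Fin m) (Fin m') F // ¬ GridIndependent k η x.1 x.2} ≤
      Nat.card {w // A w} * Nat.card (Matrix (Fin m) (Fin m') F) + Nat.card {x // B x} := by
    rw [← card_subtype_fst]
    exact card_subtype_le_add hsub
  calc _ ≤ (Nat.card {w // A w} : ℝ) * Nat.card (Matrix (Fin m) (Fin m') F) +
        Nat.card {x // B x} := by exact_mod_cast h1
    _ ≤ _ := add_le_add (mul_le_mul_of_nonneg_right hAcard (by positivity)) hBcard
    _ = _ := by ring

end Counting

end LCBC

namespace LCBC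

/-! ### Choice of parameters and limiting cost of alignment. -/

section AlignmentAsymptotics

variable {K d m m' : ℕ}

theorem shear_shear_neg {F : Type} [Field F] (Λ : Instance F K d (fun _ => m) (fun _ => m'))
    (R : Matrix (Fin m) (Fin m') F) : (Λ.shear R).shear (-R) = Λ := by
  simp [Instance.shear]

/-- Shearing with `R` kept is injective on pairs, and an instance without a good `R` makes a bad
pair with every `R`. Hence the fraction of such instances is at most the fraction of bad pairs. -/
theorem prob_not_exists_gridIndependent_le (p : ℕ) [Fact p.Prime] {n : ℕ} (hn : n ≠ 0) (η : ℕ) :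
    prob p n K d (fun _ => m) (fun _ => m')
      (fun Λ => ¬ ∃ R, GridIndependent (ZMod p) η (Λ.shear R).entry R) ≤
      (p : ℝ) ^ (η ^ Fintype.card (Coord K d m m')) *
          (Fintype.card (Coord K d m m') * η) / (p : ℝ) ^ n +
        (p : ℝ) ^ ((m + m') * η ^ Fintype.card (Coord K d m m')) / ((p : ℝ) ^ n) ^ m := by
  set F := GaloisField p n
  set W := Fintype.card (Coord K d m m')
  have h := card_not_gridIndependent_le (k := ZMod p) (F := F) (σ := Coord K d m m') (m := m)
    (m' := m') η
  rw [show Nat.card F = p ^ n from GaloisField.card p n hn, Nat.card_zmod] at h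
  have hR : (0 : ℝ) < Nat.card (Matrix (Fin m) (Fin m') F) := by exact_mod_cast Nat.card_pos
  have h1 : Nat.card {Λ : Instance F K d (fun _ => m) (fun _ => m') //
      ¬ ∃ R, GridIndependent (ZMod p) η (Λ.shear R).entry R} *
      Nat.card (Matrix (Fin m) (Fin m') F) ≤
      Nat.card {x : (Coord K d m m' → F) × Matrix (Fin m) (Fin m') F //
        ¬ GridIndependent (ZMod p) η x.1 x.2} := by
    rw [← Nat.card_prod]
    refine Nat.card_le_card_of_injective
      (fun x => ⟨((x.1.1.shear x.2).entry, x.2), fun h => x.1.2 ⟨x.2, h⟩⟩) fun x y hxy => ?_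
    simp only [Subtype.mk.injEq, Prod.mk.injEq] at hxy
    have h2 := (entryEquiv F K d m m').injective hxy.1
    refine Prod.ext (Subtype.ext ?_) hxy.2
    rw [← shear_shear_neg x.1.1 x.2, h2, hxy.2, shear_shear_neg]
  have h2 : (Nat.card {Λ : Instance F K d (fun _ => m) (fun _ => m') //
      ¬ ∃ R, GridIndependent (ZMod p) η (Λ.shear R).entry R} : ℝ) *
      Nat.card (Matrix (Fin m) (Fin m') F) ≤ _ := le_trans (by exact_mod_cast h1) h
  rw [← mul_assoc, mul_le_mul_iff_left₀ hR] at h2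
  unfold prob
  rw [div_le_iff₀ (natCard_instance_pos n), Nat.card_congr (entryEquiv (GaloisField p n) K d m m')]
  push_cast at h2
  exact h2

/-- Used with `a = 1` for the broadcast monomials and `a = 0` for the useful ones: the overhead of
the larger exponent range vanishes in the limit. -/
theorem tendsto_floor_rpow_add_pow_div {c : ℝ} (hc : 0 < c) {W : ℕ} (hW : W ≠ 0) (a : ℝ) :
    Tendsto (fun n : ℕ => ((⌊(c * n) ^ (W : ℝ)⁻¹⌋₊ : ℝ) + a) ^ W / n) atTop (𝓝 c) := by
  have hx : Tendsto (fun n : ℕ => (c * n) ^ (W : ℝ)⁻¹) atTop atTop :=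
    (tendsto_rpow_atTop (by positivity)).comp
      (tendsto_natCast_atTop_atTop.const_mul_atTop hc)
  have h1 : Tendsto (fun n : ℕ => (⌊(c * n) ^ (W : ℝ)⁻¹⌋₊ : ℝ) / (c * n) ^ (W : ℝ)⁻¹ +
      a / (c * n) ^ (W : ℝ)⁻¹) atTop (𝓝 (1 + 0)) :=
    ((tendsto_nat_floor_div_atTop (R := ℝ)).comp hx).add (hx.const_div_atTop a)
  have h2 := (h1.pow W).const_mul c
  simp only [add_zero, one_pow, mul_one] at h2
  refine h2.congr' ?_
  filter_upwards [eventually_ne_atTop 0] with n hn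
  have hn' : (0 : ℝ) < n := by positivity
  rw [← add_div, div_pow, Real.rpow_inv_natCast_pow (by positivity) hW]
  field_simp

theorem floor_rpow_pow_le {c : ℝ} (hc : 0 ≤ c) {W : ℕ} (hW : W ≠ 0) (n : ℕ) :
    ((⌊(c * n) ^ (W : ℝ)⁻¹⌋₊ : ℝ)) ^ W ≤ c * n := by
  calc _ ≤ ((c * n) ^ (W : ℝ)⁻¹) ^ W := by
        gcongr
        exact Nat.floor_le (by positivity)
    _ = c * n := Real.rpow_inv_natCast_pow (by positivity) hW

theorem pow_div_pow_le {x : ℝ} (hx : 1 ≤ x) {a b n : ℕ} {δ : ℝ} (h : (a : ℝ) ≤ b - δ * n) :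
    x ^ a / x ^ b ≤ (x ^ (-δ)) ^ n := by
  have hx0 : 0 < x := by linarith
  rw [← Real.rpow_natCast x a, ← Real.rpow_natCast x b, ← Real.rpow_sub hx0,
    ← Real.rpow_natCast (x ^ (-δ)), ← Real.rpow_mul hx0.le]
  exact Real.rpow_le_rpow_of_exponent_le hx (by linarith)

/-- `c < 1` lets `p ^ n` beat the roughly `p ^ (c * n)` single polynomials; `(m + m') * c < m` lets
`p ^ (n * m)` beat the tuples of them. -/
theorem whp_exists_gridIndependent (p : ℕ) [Fact p.Prime] {c : ℝ} (hc : 0 ≤ c) (hc1 : c < 1)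
    (hcm : (m + m') * c < m) (hW : Fintype.card (Coord K d m m') ≠ 0) :
    Whp p K d (fun _ => m) (fun _ => m') fun n Λ => ∃ R, GridIndependent (ZMod p)
      ⌊(c * n) ^ (Fintype.card (Coord K d m m') : ℝ)⁻¹⌋₊ (Λ.shear R).entry R := by
  set W := Fintype.card (Coord K d m m')
  have hp : 1 < (p : ℝ) := by exact_mod_cast (Fact.out : p.Prime).one_lt
  have hp0 : 0 < (p : ℝ) := by linarith
  have hlt : ∀ {δ : ℝ}, 0 < δ → (p : ℝ) ^ (-δ) < 1 := fun hδ =>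
    Real.rpow_lt_one_of_one_lt_of_neg hp (by linarith)
  have hb : Tendsto (fun n : ℕ => W * (n * ((p : ℝ) ^ (-(1 - c))) ^ n) +
      ((p : ℝ) ^ (-(m - (m + m') * c))) ^ n) atTop (𝓝 0) := by
    simpa using ((tendsto_self_mul_const_pow_of_lt_one (by positivity)
      (hlt (sub_pos.2 hc1))).const_mul (W : ℝ)).add
      (tendsto_pow_atTop_nhds_zero_of_lt_one (by positivity) (hlt (sub_pos.2 hcm)))
  refine whp_of_prob_not_le hb ((eventually_ne_atTop 0).mono fun n hn => ?_)
  refine (prob_not_exists_gridIndependent_le p hn _).trans ?_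
  set η := ⌊(c * n) ^ (W : ℝ)⁻¹⌋₊
  have hη : (η : ℝ) ^ W ≤ c * n := floor_rpow_pow_le hc hW n
  have hηn : (η : ℝ) ≤ n := by
    have : (η : ℝ) ≤ η ^ W := by exact_mod_cast Nat.le_self_pow hW η
    nlinarith [(Nat.cast_nonneg n : (0 : ℝ) ≤ n)]
  have h1 := pow_div_pow_le hp.le (a := η ^ W) (b := n) (n := n) (δ := 1 - c)
    (by push_cast; linarith)
  have h2 := pow_div_pow_le hp.le (a := (m + m') * η ^ W) (b := n * m) (n := n)
    (δ := m - (m + m') * c) (by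
      push_cast
      have := mul_le_mul_of_nonneg_left hη (show (0 : ℝ) ≤ m + m' by positivity)
      linarith)
  rw [← pow_mul]
  refine add_le_add ?_ h2
  calc (p : ℝ) ^ (η ^ W) * (W * η) / (p : ℝ) ^ n
      = W * (η * ((p : ℝ) ^ (η ^ W) / (p : ℝ) ^ n)) := by ring
    _ ≤ _ := by gcongr

theorem logb_card_galoisField (p : ℕ) [Fact p.Prime] {n : ℕ} (hn : n ≠ 0) :
    Real.logb (Nat.card (GaloisField p n)) (Nat.card (ZMod p)) = (n : ℝ)⁻¹ := by
  have hp : 1 < (p : ℝ) := by exact_mod_cast (Fact.out : p.Prime).one_lt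
  rw [GaloisField.card p n hn, Nat.card_zmod, Nat.cast_pow, Real.logb, Real.log_pow]
  have := Real.log_pos hp
  field_simp

/-- Generic instances have cost at most `md / (m + m')`, asymptotically. -/
theorem whp_optimalCost_lt (p : ℕ) [Fact p.Prime] (hK : 0 < K) (hd : 0 < d) (hm : 0 < m + m')
    {ε : ℝ} (hε : 0 < ε) :
    Whp p K d (fun _ => m) (fun _ => m')
      fun _ Λ => optimalCost Λ < (m : ℝ) * d / ((m : ℝ) + m') + ε := by
  rcases Nat.eq_zero_or_pos m with rfl | hm0
  · refine whp_of_forall (Eventually.of_forall fun n Λ => (optimalCost_le_mul Λ).trans_lt ?_)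
    simpa using hε
  set W := Fintype.card (Coord K d m m')
  have hW : W ≠ 0 := by
    simp only [W, Fintype.card_prod, Fintype.card_sum, Fintype.card_fin]
    positivity
  have hm0' : (0 : ℝ) < m := by exact_mod_cast hm0
  have hK' : (0 : ℝ) < K := by exact_mod_cast hK
  have hN : (0 : ℝ) < (m : ℝ) + m' := by positivity
  -- `δ < m` keeps `c` positive, and `K * δ < ε` pays for the `K` residual projections, which cost
  -- about `δ` each.
  obtain ⟨δ, hδ0, hδ⟩ := exists_between (lt_min hm0' (div_pos hε hK'))
  obtain ⟨hδm, hδε⟩ := lt_min_iff.1 hδ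
  rw [lt_div_iff₀ hK'] at hδε
  set c : ℝ := (m - δ) / (m + m')
  have hc : 0 < c := div_pos (by linarith) hN
  have hNc : ((m : ℝ) + m') * c = m - δ := by
    simp only [c]
    field_simp
  have hc1 : c < 1 := (div_lt_one hN).2 (by
    have : (0 : ℝ) ≤ m' := Nat.cast_nonneg _
    linarith)
  have hlim := ((tendsto_floor_rpow_add_pow_div hc hW 1).const_mul (d : ℝ)).add
    ((((tendsto_floor_rpow_add_pow_div hc hW 0).const_mul ((m : ℝ) + m')).const_sub
      (m : ℝ)).const_mul (K : ℝ))
  have hlt : d * c + K * (m - (m + m') * c) < (m : ℝ) * d / ((m : ℝ) + m') + ε := by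
    have : d * c ≤ (m : ℝ) * d / ((m : ℝ) + m') := by
      rw [mul_comm (m : ℝ), mul_div_assoc]
      refine mul_le_mul_of_nonneg_left ((div_le_div_iff_of_pos_right hN).2 ?_) (Nat.cast_nonneg d)
      linarith
    rw [hNc]
    linarith
  refine (whp_exists_gridIndependent p hc.le hc1 (by linarith) hW).mono ?_
  filter_upwards [hlim.eventually_lt_const hlt, eventually_ne_atTop 0] with n h1 hn Λ ⟨R, hR⟩
  refine (optimalCost_le_of_gridIndependent Λ R _ hR).trans_lt ?_
  rw [logb_card_galoisField p hn]
  simpa only [add_zero, div_eq_mul_inv, mul_assoc] using h1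

end AlignmentAsymptotics

end LCBC

/-! ### Assembly of the bounds. -/

theorem mainTheorem5 (p : ℕ) [Fact p.Prime] (K d m m' : ℕ) (hK : 1 ≤ K) :
    (d ≤ m' → LCBC.IsGenericCost p K d (fun _ => m) (fun _ => m') 0) ∧
    (m' ≤ d → d ≤ m + m' →
      LCBC.IsGenericCost p K d (fun _ => m) (fun _ => m') ((d : ℝ) - (m' : ℝ))) ∧
    (K * (m + m') ≤ d →
      LCBC.IsGenericCost p K d (fun _ => m) (fun _ => m') ((K : ℝ) * (m : ℝ))) ∧
    (1 < (d : ℝ) / ((m : ℝ) + (m' : ℝ)) → (d : ℝ) / ((m : ℝ) + (m' : ℝ)) ≤ (K : ℝ) →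
      -- bounds on the generic cost, if it exists
      (∀ Δg : ℝ, LCBC.IsGenericCost p K d (fun _ => m) (fun _ => m') Δg →
        max ((d : ℝ) - (m' : ℝ) * (⌈(d : ℝ) / ((m : ℝ) + (m' : ℝ))⌉ : ℝ))
            ((m : ℝ) * (⌊(d : ℝ) / ((m : ℝ) + (m' : ℝ))⌋ : ℝ)) ≤ Δg ∧
          Δg ≤ (m : ℝ) * (d : ℝ) / ((m : ℝ) + (m' : ℝ))) ∧
      -- the generic cost exists if `m + m'` divides `d`
      (m + m' ∣ d → LCBC.IsGenericCost p K d (fun _ => m) (fun _ => m')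
        ((m : ℝ) * (d : ℝ) / ((m : ℝ) + (m' : ℝ)))) ∧
      -- the ratio of the upper bound to the lower bound
      (0 < m →
        ((m : ℝ) * (d : ℝ) / ((m : ℝ) + (m' : ℝ))) /
            ((m : ℝ) * (⌊(d : ℝ) / ((m : ℝ) + (m' : ℝ))⌋ : ℝ)) =
          ((d : ℝ) / ((m : ℝ) + (m' : ℝ))) / (⌊(d : ℝ) / ((m : ℝ) + (m' : ℝ))⌋ : ℝ)) ∧
      ((d : ℝ) / ((m : ℝ) + (m' : ℝ))) / (⌊(d : ℝ) / ((m : ℝ) + (m' : ℝ))⌋ : ℝ) ≤ 2 ∧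
      -- the generic capacity, if it exists, is determined within a factor of `2`
      (∀ C : ENNReal, LCBC.IsGenericCapacity p K d (fun _ => m) (fun _ => m') C →
        (ENNReal.ofReal ((m : ℝ) * (d : ℝ) / ((m : ℝ) + (m' : ℝ))))⁻¹ ≤ C ∧
          C ≤ 2 * (ENNReal.ofReal ((m : ℝ) * (d : ℝ) / ((m : ℝ) + (m' : ℝ))))⁻¹)) := by
  have hge : ∀ {t r : ℕ} {a : ℝ}, t ≤ K → r ≤ d → r ≤ t * (m + m') → a = r - t * m' →
      LCBC.Whp p K d (fun _ => m) (fun _ => m') fun _ Λ => a ≤ LCBC.optimalCost Λ := by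
    rintro t r a ht hr hr' rfl
    exact LCBC.whp_le_optimalCost p ht hr hr'
  refine ⟨fun hd => ?_, fun hd hd' => ?_, fun hd => ?_, fun h1 h2 => ?_⟩
  · refine LCBC.isGenericCost_of_whp p
      (LCBC.whp_of_forall (Eventually.of_forall fun n Λ => LCBC.optimalCost_nonneg Λ))
      fun ε hε => (LCBC.whp_optimalCost_le_of_le p (r := 0) (Nat.zero_le d) hd).mono
        (Eventually.of_forall fun n Λ h => ?_)
    rw [Nat.cast_zero] at h
    linarith
  · refine LCBC.isGenericCost_of_whp p (hge (t := 1) (r := d) hK le_rfl (by omega) (by simp))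
      fun ε hε => (LCBC.whp_optimalCost_le_of_le p (r := d - m') (by omega) (by omega)).mono
        (Eventually.of_forall fun n Λ h => ?_)
    rw [Nat.cast_sub hd] at h
    linarith
  · exact LCBC.isGenericCost_of_whp p
      (hge (t := K) (r := K * (m + m')) le_rfl hd le_rfl (by push_cast; ring))
      fun ε hε => LCBC.whp_of_forall (Eventually.of_forall fun n Λ =>
        (LCBC.optimalCost_le_mul Λ).trans_lt (by linarith))
  have hN : 0 < m + m' := by
    by_contra h
    obtain ⟨rfl, rfl⟩ : m = 0 ∧ m' = 0 := by omega
    norm_num at h1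
  have hN' : (0 : ℝ) < (m : ℝ) + m' := by exact_mod_cast hN
  have hd : 0 < d := by
    rw [one_lt_div hN'] at h1
    have : (0 : ℝ) < d := hN'.trans h1
    exact_mod_cast this
  set x : ℝ := (d : ℝ) / ((m : ℝ) + (m' : ℝ)) with hx
  have hdx : (d : ℝ) = x * (m + m') := by rw [hx]; field_simp
  have hmx : (m : ℝ) * d / ((m : ℝ) + m') = m * x := by rw [hx, mul_div_assoc]
  have hx0 : 0 ≤ x := by linarith
  have hfloor : ((⌊x⌋ : ℤ) : ℝ) = (⌊x⌋₊ : ℝ) := (natCast_floor_eq_intCast_floor hx0).symm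
  have hceil : ((⌈x⌉ : ℤ) : ℝ) = (⌈x⌉₊ : ℝ) := (natCast_ceil_eq_intCast_ceil hx0).symm
  have hfK : ⌊x⌋₊ ≤ K := Nat.floor_le_of_le h2
  have hf : ⌊x⌋₊ * (m + m') ≤ d := by
    have : (⌊x⌋₊ : ℝ) * (m + m') ≤ d := by
      rw [hdx]
      exact mul_le_mul_of_nonneg_right (Nat.floor_le hx0) hN'.le
    exact_mod_cast this
  have hc : d ≤ ⌈x⌉₊ * (m + m') := by
    have : (d : ℝ) ≤ ⌈x⌉₊ * (m + m') := by
      rw [hdx]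
      exact mul_le_mul_of_nonneg_right (Nat.le_ceil x) hN'.le
    exact_mod_cast this
  -- `⌊x⌋` users with all their columns, `r = ⌊x⌋ * (m + m')`; the next bound uses `⌈x⌉` users and
  -- full rank `r = d`.
  have hlow := hge (a := m * (⌊x⌋ : ℝ)) hfK hf le_rfl (by rw [hfloor]; push_cast; ring)
  have hlow' := hge (a := d - m' * (⌈x⌉ : ℝ)) (Nat.ceil_le.2 h2) le_rfl hc (by rw [hceil]; ring)
  have hup : ∀ ε : ℝ, 0 < ε → LCBC.Whp p K d (fun _ => m) (fun _ => m') fun _ Λ =>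
      LCBC.optimalCost Λ < m * x + ε := fun ε hε => by
    rw [← hmx]
    exact LCBC.whp_optimalCost_lt p hK hd hN hε
  have hf1 : (1 : ℝ) ≤ (⌊x⌋ : ℝ) := by exact_mod_cast Int.le_floor.2 (by exact_mod_cast h1.le)
  -- `x < ⌊x⌋ + 1 ≤ 2 * ⌊x⌋`, because `⌊x⌋ ≥ 1`; this is the source of the factor 2.
  have hx2 : x ≤ 2 * (⌊x⌋ : ℝ) := by linarith [Int.lt_floor_add_one x]
  have hm : (0 : ℝ) ≤ m := Nat.cast_nonneg m
  rw [hmx]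
  refine ⟨fun Δg h => ⟨max_le (h.le p hlow') (h.le p hlow), h.ge p hup⟩, fun hdvd => ?_,
    fun hm0 => ?_, ?_, ?_⟩
  · obtain ⟨t, ht⟩ := hdvd
    have hxt : x = t := by
      rw [hx, ht]
      push_cast
      field_simp
    have htK : t ≤ K := by
      rw [hxt] at h2
      exact_mod_cast h2
    refine LCBC.isGenericCost_of_whp p (hge htK le_rfl (by rw [ht, mul_comm]) ?_) hup
    rw [hdx, hxt]
    ring
  · have : (m : ℝ) ≠ 0 := by positivity
    exact mul_div_mul_left _ _ this
  · rwa [div_le_iff₀ (by linarith)]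
  · rintro C ⟨Δg, h, rfl⟩
    refine ⟨ENNReal.inv_le_inv.2 (ENNReal.ofReal_le_ofReal (h.ge p hup)), ?_⟩
    have h3 : m * x ≤ 2 * Δg := by
      have := h.le p hlow
      nlinarith
    have h4 : ENNReal.ofReal (m * x) ≤ 2 * ENNReal.ofReal Δg := by
      rw [← ENNReal.ofReal_ofNat 2, ← ENNReal.ofReal_mul (by norm_num)]
      exact ENNReal.ofReal_le_ofReal h3
    have h5 := ENNReal.inv_le_inv.2 h4
    rw [ENNReal.mul_inv (Or.inl (by norm_num)) (Or.inl (by norm_num))] at h5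
    calc (ENNReal.ofReal Δg)⁻¹ = 2 * (2⁻¹ * (ENNReal.ofReal Δg)⁻¹) := by
          rw [← mul_assoc, ENNReal.mul_inv_cancel (by norm_num) (by norm_num), one_mul]
      _ ≤ _ := by gcongr
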